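/- Let $d\ge 1$ and let $\mathcal H$ be a separable complex Hilbert space. Let $\mathcal F=\mathcal H\otimes\mathcal F_{\mathrm b}$, where $\mathcal F_{\mathrm b}$ is the boson Fock space over $L^2(\mathbb R^d)$; identify $\mathcal F$ with $\bigoplus_{n\ge 0}L^2_{\mathrm{sym}}((\mathbb R^d)^n;\mathcal H)$. Let $A$ be a self-adjoint operator in $\mathcal H$ bounded from below, and let $\omega:\mathbb R^d\to[0,\infty)$ be continuous with $\omega(k)>0$ for $k\neq 0$ and $\inf_{|k|>\varepsilon}\omega(k)>0$ for every $\varepsilon>0$. Put $H_0=A\otimes I+I\otimes d\Gamma(\omega)$ on $D(A\otimes I)\cap D(I\otimes d\Gamma(\omega))$ and $N=I\otimes d\Gamma(1)$; for $f\in L^2(\mathbb R^d)$ let $a(f)$ be the annihilation operator $(a(f)\Psi)^{(n)}(k_1,\dots,k_n)=\sqrt{n+1}\int\overline{f(q)}\,\Psi^{(n+1)}(q,k_1,\dots,k_n)\,dq$ on its maximal domain. Let $H_{\mathrm{QFT}}=H_0+H_{\mathrm I}$ be self-adjoint with $D(H_{\mathrm{QFT}})=D(H_0)$, and let $\Psi_{\mathrm{QFT}}$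 be a normalized ground state: $\sigma(H_{\mathrm{QFT}})$ is bounded below, $\|\Psi_{\mathrm{QFT}}\|=1$ and $H_{\mathrm{QFT}}\Psi_{\mathrm{QFT}}=E_0\Psi_{\mathrm{QFT}}$ with $E_0=\inf\sigma(H_{\mathrm{QFT}})$. Put $\widehat H=H_{\mathrm{QFT}}-E_0$. For every $k\in\mathbb R^d\setminus\{0\}$ let $B_{\mathrm{PT}}(k)$ be an operator in $\mathcal F$ with $D(B_{\mathrm{PT}}(k))\supset D(H_0)$ such that: (1) $k\mapsto(\Phi,B_{\mathrm{PT}}(k)\Psi)$ is measurable for all $\Psi\in D(H_0)$ and $\Phi\in\mathcal F$, and for every $f\in C_0^\infty(\mathbb R^d\setminus\{0\})$ one has $\Psi_{\mathrm{QFT}}\in D(a(f))$ and $a(f)\Psi_{\mathrm{QFT}}=-\int\overline{f(k)}\,(\widehat H+\omega(k))^{-1}B_{\mathrm{PT}}(k)\Psi_{\mathrm{QFT}}\,dk$; (2) $(\widehat H+\omega(k))^{-1}B_{\mathrm{PT}}(k)$ is bounded for every $k\ne0$, and $M_\varepsilon:=\big(\int_{|k|>\varepsilon}\|(\widehat H+\omega(k))^{-1}B_{\mathrm{PT}}(k)\|^2dk\big)^{1/2}<\infty$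 for every $\varepsilon>0$. Let $K_{\mathrm{PT}}(k)=(\widehat H+\omega(k))^{-1}B_{\mathrm{PT}}(k)\Psi_{\mathrm{QFT}}$ for $k\neq0$, and let $T_{\mathrm{PT}}:\mathcal F\to L^2(\mathbb R^d)$ be the maximal Carleman operator induced by $K_{\mathrm{PT}}$: $D(T_{\mathrm{PT}})=\{\Phi\in\mathcal F:(K_{\mathrm{PT}}(\cdot),\Phi)\in L^2(\mathbb R^d)\}$ and $(T_{\mathrm{PT}}\Phi)(k)=(K_{\mathrm{PT}}(k),\Phi)$. Then the following are equivalent: (i) $\Psi_{\mathrm{QFT}}\in D(N^{1/2})$; (ii) $\|K_{\mathrm{PT}}(\cdot)\|_{\mathcal F}\in L^2(\mathbb R^d)$; (iii) $T_{\mathrm{PT}}$ is a Hilbert–Schmidt operator (everywhere defined, bounded, and $\sum_i\|T_{\mathrm{PT}}e_i\|^2<\infty$ for an orthonormal basis $(e_i)$ of $\mathcal F$). If they hold, then the limit $M_0:=\lim_{\varepsilon\downarrow0}M_\varepsilon$ exists in $[0,\infty]$, $\|T_{\mathrm{PT}}\|\le M_0$, and $\|T_{\mathrm{PT}}\|<\infty$.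 -/

import Mathlib

open MeasureTheory Filter Topology
open scoped ENNReal ComplexConjugate

namespace QFT

noncomputable section

/-! ### Unbounded operators -/

section Operators

variable {F G : Type*} [NormedAddCommGroup F] [InnerProductSpace ℂ F]
  [NormedAddCommGroup G] [InnerProductSpace ℂ G]

/-- The value `S x` of a partially defined operator. It is only used for `x` in the domain of `S`;
outside the domain the value is the dummy `0`. -/
def applyPMap (S : F →ₗ.[ℂ] G) (x : F) : G :=
  open Classical in if h : x ∈ S.domain then S ⟨x, h⟩ else 0

/-- A partially defined operator is bounded: `‖S x‖ ≤ C ‖x‖` on its domain. -/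
def IsBddPMap (S : F →ₗ.[ℂ] G) : Prop :=
  ∃ C : ℝ, ∀ x : S.domain, ‖S x‖ ≤ C * ‖(x : F)‖

/-- The operator norm, with values in `[0, ∞]`: the supremum of `‖S x‖` over the `x` in the domain
with `‖x‖ ≤ 1`. For a bounded densely defined operator it is also the norm of the continuous
extension to the whole space. -/
def opENorm (S : F →ₗ.[ℂ] G) : ℝ≥0∞ :=
  ⨆ (x : S.domain) (_ : ‖(x : F)‖ ≤ 1), ‖S x‖ₑ

/-- `R` is a bounded everywhere defined two-sided inverse of `S - z`. -/
def IsResolventAt (S : F →ₗ.[ℂ] F) (z : ℂ) (R : F →L[ℂ] F) : Prop :=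
  (∀ y : F, ∃ h : R y ∈ S.domain, S ⟨R y, h⟩ - z • R y = y) ∧
    ∀ x : S.domain, R (S x - z • (x : F)) = x

/-- The spectrum of a (closed) partially defined operator. -/
def pmapSpectrum (S : F →ₗ.[ℂ] F) : Set ℂ :=
  {z | ¬ ∃ R : F →L[ℂ] F, IsResolventAt S z R}

/-- The resolvent `(S - z)⁻¹` (the dummy `0` if `z` is in the spectrum). -/
def resolventAt (S : F →ₗ.[ℂ] F) (z : ℂ) : F →L[ℂ] F :=
  open Classical in if h : ∃ R : F →L[ℂ] F, IsResolventAt S z R then h.choose else 0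

/-- The real points of the spectrum; for a self-adjoint operator this is the whole spectrum. -/
def realSpectrum (S : F →ₗ.[ℂ] F) : Set ℝ := {x | (x : ℂ) ∈ pmapSpectrum S}

/-- The ground state energy `inf σ(S)`. -/
def groundEnergy (S : F →ₗ.[ℂ] F) : ℝ := sInf (realSpectrum S)

/-- `Ψ` is a normalized ground state of `S`: the spectrum is bounded below, and `Ψ` is a unit
eigenvector with eigenvalue `inf σ(S)`. -/
structure IsGroundState (S : F →ₗ.[ℂ] F) (Ψ : F) : Prop where
  bddBelow : BddBelow (realSpectrum S)
  norm_eq_one : ‖Ψ‖ = 1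
  eigen : ∃ h : Ψ ∈ S.domain, S ⟨Ψ, h⟩ = (groundEnergy S : ℂ) • Ψ

/-- The operator is bounded below as a quadratic form. -/
def IsSemibounded (S : F →ₗ.[ℂ] F) : Prop :=
  ∃ c : ℝ, ∀ x : S.domain, c * ‖(x : F)‖ ^ 2 ≤ (inner ℂ (x : F) (S x)).re

/-- Hilbert-Schmidt operators: everywhere defined, bounded, and `∑ ‖T e‖² < ∞` over some complete
orthonormal system. -/
def IsHilbertSchmidt (T : F →ₗ.[ℂ] G) : Prop :=
  T.domain = ⊤ ∧ IsBddPMap T ∧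
    ∃ (w : Set F) (b : HilbertBasis w ℂ F), Summable fun i => ‖applyPMap T (b i)‖ ^ 2

end Operators

/-! ### The state space -/

/-- The momentum space `ℝ^d`. -/
abbrev Mom (d : ℕ) : Type := EuclideanSpace ℝ (Fin d)

section FockSpace

variable (d : ℕ) (H : Type*) [NormedAddCommGroup H] [InnerProductSpace ℂ H]

theorem measurePreserving_perm {d n : ℕ} (σ : Equiv.Perm (Fin n)) :
    MeasurePreserving (fun k : Fin n → Mom d => k ∘ σ) volume volume := by
  have e : (fun k : Fin n → Mom d => k ∘ σ)
      = MeasurableEquiv.piCongrLeft (fun _ : Fin n => Mom d) σ.symm := by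
    funext k i
    simp [MeasurableEquiv.coe_piCongrLeft, Equiv.piCongrLeft_apply]
  rw [e]
  exact volume_measurePreserving_piCongrLeft (fun _ : Fin n => Mom d) σ.symm

/-- The closed subspace `L²_sym((ℝ^d)^n; H)` of permutation symmetric functions
in `L²((ℝ^d)^n; H)`; for `n = 0` this is `H`. -/
def symL2 (n : ℕ) : Submodule ℂ (Lp H 2 (volume : Measure (Fin n → Mom d))) where
  carrier := {f | ∀ σ : Equiv.Perm (Fin n), (fun k => f (k ∘ σ)) =ᵐ[volume] f}
  zero_mem' := by
    intro σ
    have hz := Lp.coeFn_zero H 2 (volume : Measure (Fin n → Mom d))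
    have hσ := (measurePreserving_perm (d := d) σ).quasiMeasurePreserving.ae_eq_comp hz
    filter_upwards [hz, hσ] with k h1 h2
    simp only [Function.comp_apply, Pi.zero_apply] at h1 h2
    rw [h1, h2]
  add_mem' := by
    intro f g hf hg σ
    have hz := Lp.coeFn_add f g
    have hσ := (measurePreserving_perm (d := d) σ).quasiMeasurePreserving.ae_eq_comp hz
    filter_upwards [hz, hσ, hf σ, hg σ] with k h1 h2 h3 h4
    simp only [Function.comp_apply, Pi.add_apply] at h1 h2
    rw [h1, h2, h3, h4]
  smul_mem' := by
    intro c f hf σ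
    have hz := Lp.coeFn_smul c f
    have hσ := (measurePreserving_perm (d := d) σ).quasiMeasurePreserving.ae_eq_comp hz
    filter_upwards [hz, hσ, hf σ] with k h1 h2 h3
    simp only [Function.comp_apply, Pi.smul_apply] at h1 h2
    rw [h1, h2, h3]

theorem isClosed_symL2 (n : ℕ) :
    IsClosed (symL2 d H n : Set (Lp H 2 (volume : Measure (Fin n → Mom d)))) := by
  have : (symL2 d H n : Set (Lp H 2 (volume : Measure (Fin n → Mom d)))) =
      ⋂ σ : Equiv.Perm (Fin n),
        {f | Lp.compMeasurePreserving _ (measurePreserving_perm (d := d) σ) f = f} := by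
    ext f
    simp only [Set.mem_iInter, Set.mem_ofPred_eq]
    refine forall_congr' fun σ => ?_
    have h := Lp.coeFn_compMeasurePreserving f (measurePreserving_perm (d := d) σ)
    constructor
    · intro hf
      exact Lp.ext (h.trans hf)
    · intro hf
      rw [hf] at h
      exact h.symm
  rw [this]
  exact isClosed_iInter fun σ =>
    isClosed_eq (Lp.isometry_compMeasurePreserving _).continuous continuous_id

instance instCompleteSymL2 [CompleteSpace H] (n : ℕ) : CompleteSpace (symL2 d H n) :=
  (isClosed_symL2 d H n).completeSpace_coe

/-- The state space `H ⊗ F_b(L²(ℝ^d))`, in its standard realization as the Hilbert space direct sum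
`⨁ₙ L²_sym((ℝ^d)^n; H)`; a tensor `u ⊗ ψ` is the sequence of functions `k ↦ ψ⁽ⁿ⁾(k) u`. -/
abbrev Fock : Type _ := lp (fun n : ℕ => symL2 d H n) 2

variable {d H}

/-- The `n`-boson component of `Ψ`, as an `H`-valued function of `n` momenta. -/
def comp (Ψ : Fock d H) (n : ℕ) : (Fin n → Mom d) → H :=
  ((Ψ n : symL2 d H n) : Lp H 2 (volume : Measure (Fin n → Mom d)))

theorem comp_zero (n : ℕ) : comp (0 : Fock d H) n =ᵐ[volume] 0 :=
  Lp.coeFn_zero H 2 (volume : Measure (Fin n → Mom d))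

theorem comp_add (Ψ Φ : Fock d H) (n : ℕ) :
    comp (Ψ + Φ) n =ᵐ[volume] comp Ψ n + comp Φ n :=
  Lp.coeFn_add (p := 2) (μ := (volume : Measure (Fin n → Mom d))) _ _

theorem comp_smul (c : ℂ) (Ψ : Fock d H) (n : ℕ) :
    comp (c • Ψ) n =ᵐ[volume] c • comp Ψ n :=
  Lp.coeFn_smul (p := 2) (μ := (volume : Measure (Fin n → Mom d))) _ _

theorem ext_comp {Ψ Φ : Fock d H} (h : ∀ n, comp Ψ n =ᵐ[volume] comp Φ n) : Ψ = Φ := by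
  apply lp.ext
  funext n
  exact Subtype.ext (Lp.ext (h n))

theorem memLp_comp (Ψ : Fock d H) (n : ℕ) : MemLp (comp Ψ n) 2 volume :=
  Lp.memLp _

/-! ### Operators on the state space -/

/-- The graph of `A ⊗ I`: the operator `A` acts on the values, `(A Ψ)⁽ⁿ⁾(k) = A (Ψ⁽ⁿ⁾(k))`. -/
def tensorIdGraph (A : H →ₗ.[ℂ] H) : Submodule ℂ (Fock d H × Fock d H) where
  carrier := {p | ∀ n, ∀ᵐ k, (comp p.1 n k, comp p.2 n k) ∈ A.graph}
  zero_mem' := by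
    intro n
    filter_upwards [comp_zero (d := d) (H := H) n] with k h
    simp only [Prod.fst_zero, Prod.snd_zero, h]
    exact A.graph.zero_mem
  add_mem' := by
    intro p q hp hq n
    filter_upwards [hp n, hq n, comp_add p.1 q.1 n, comp_add p.2 q.2 n] with k h1 h2 h3 h4
    simp only [Prod.fst_add, Prod.snd_add, h3, h4]
    exact A.graph.add_mem h1 h2
  smul_mem' := by
    intro c p hp n
    filter_upwards [hp n, comp_smul c p.1 n, comp_smul c p.2 n] with k h1 h3 h4
    simp only [Prod.smul_fst, Prod.smul_snd, h3, h4]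
    exact A.graph.smul_mem c h1

theorem tensorIdGraph_single_valued (A : H →ₗ.[ℂ] H) (p : Fock d H × Fock d H)
    (hp : p ∈ tensorIdGraph A) (h0 : p.1 = 0) : p.2 = 0 := by
  refine ext_comp fun n => ?_
  filter_upwards [hp n, comp_zero (d := d) (H := H) n] with k h1 h2
  rw [h0, h2] at h1
  rw [h2]
  exact A.graph_fst_eq_zero_snd h1 rfl

/-- The operator `A ⊗ I` with its natural maximal domain. -/
def tensorId (A : H →ₗ.[ℂ] H) : Fock d H →ₗ.[ℂ] Fock d H := (tensorIdGraph A).toLinearPMap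

theorem tensorId_graph (A : H →ₗ.[ℂ] H) :
    (tensorId A : Fock d H →ₗ.[ℂ] Fock d H).graph = tensorIdGraph A :=
  Submodule.toLinearPMap_graph_eq _ (tensorIdGraph_single_valued A)

/-- The graph of the multiplication operator by the functions `g n` of `n` momenta. -/
def mulGraph (g : ∀ n : ℕ, (Fin n → Mom d) → ℝ) : Submodule ℂ (Fock d H × Fock d H) where
  carrier := {p | ∀ n, ∀ᵐ k, comp p.2 n k = (g n k : ℂ) • comp p.1 n k}
  zero_mem' := by
    intro n
    filter_upwards [comp_zero (d := d) (H := H) n] with k h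
    simp [h]
  add_mem' := by
    intro p q hp hq n
    filter_upwards [hp n, hq n, comp_add p.1 q.1 n, comp_add p.2 q.2 n] with k h1 h2 h3 h4
    simp only [Prod.fst_add, Prod.snd_add, h3, h4, Pi.add_apply, h1, h2, smul_add]
  smul_mem' := by
    intro c p hp n
    filter_upwards [hp n, comp_smul c p.1 n, comp_smul c p.2 n] with k h1 h3 h4
    simp only [Prod.smul_fst, Prod.smul_snd, h3, h4, Pi.smul_apply, h1]
    rw [smul_comm]

theorem mulGraph_single_valued (g : ∀ n : ℕ, (Fin n → Mom d) → ℝ) (p : Fock d H × Fock d H)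
    (hp : p ∈ mulGraph g) (h0 : p.1 = 0) : p.2 = 0 := by
  refine ext_comp fun n => ?_
  filter_upwards [hp n, comp_zero (d := d) (H := H) n] with k h1 h2
  rw [h0, h2] at h1
  rw [h2, h1]
  simp

/-- The maximal multiplication operator by the functions `g n` of `n` momenta. -/
def mulOp (g : ∀ n : ℕ, (Fin n → Mom d) → ℝ) : Fock d H →ₗ.[ℂ] Fock d H :=
  (mulGraph g).toLinearPMap

theorem mulOp_graph (g : ∀ n : ℕ, (Fin n → Mom d) → ℝ) :
    (mulOp g : Fock d H →ₗ.[ℂ] Fock d H).graph = mulGraph g :=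
  Submodule.toLinearPMap_graph_eq _ (mulGraph_single_valued g)

/-- `I ⊗ dΓ(h)`, the second quantization of multiplication by the real function `h`: on the
`n`-boson sector it is multiplication by `h(k₁) + ⋯ + h(kₙ)`. -/
def dGamma (h : Mom d → ℝ) : Fock d H →ₗ.[ℂ] Fock d H := mulOp fun _ k => ∑ j, h (k j)

/-- The square root of `I ⊗ dΓ(h)` for `h ≥ 0`. -/
def sqrtDGamma (h : Mom d → ℝ) : Fock d H →ₗ.[ℂ] Fock d H :=
  mulOp fun _ k => Real.sqrt (∑ j, h (k j))

variable (d H) in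
/-- The boson number operator `N = I ⊗ dΓ(1)`. -/
def numberOp : Fock d H →ₗ.[ℂ] Fock d H := dGamma fun _ => 1

variable (d H) in
/-- The square root `N^{1/2}` of the number operator. -/
def sqrtNumberOp : Fock d H →ₗ.[ℂ] Fock d H := sqrtDGamma fun _ => 1

/-- The free Hamiltonian `H₀ = A ⊗ I + I ⊗ dΓ(ω)`, on the intersection of the two domains. -/
def freeHamiltonian (A : H →ₗ.[ℂ] H) (ω : Mom d → ℝ) : Fock d H →ₗ.[ℂ] Fock d H :=
  tensorId A + dGamma ω

theorem ae_memLp_slice (Ψ : Fock d H) (n : ℕ) : ∀ᵐ k : Fin n → Mom d,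
    MemLp (fun q : Mom d => comp Ψ (n + 1) (Fin.cons q k)) 2 volume := by
  have hmp := (volume_preserving_piFinSuccAbove (fun _ : Fin (n + 1) => Mom d) 0).symm
  have h1 := (memLp_comp Ψ (n + 1)).comp_measurePreserving hmp
  have h2 : MemLp (fun p : (Fin n → Mom d) × Mom d =>
      comp Ψ (n + 1) (Fin.cons p.2 p.1)) 2 (volume.prod volume) := by
    have h3 := h1.comp_measurePreserving
      (Measure.measurePreserving_swap (μ := (volume : Measure (Fin n → Mom d)))
        (ν := (volume : Measure (Mom d))))
    refine h3.ae_eq (Eventually.of_forall fun p => ?_)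
    simp [MeasurableEquiv.piFinSuccAbove_symm_apply, Fin.insertNthEquiv]
  have h4 := h2.1.prodMk_left
  have h5 := ((memLp_two_iff_integrable_sq_norm h2.1).1 h2).prod_right_ae
  filter_upwards [h4, h5] with k h6 h7
  exact (memLp_two_iff_integrable_sq_norm h6).2 h7

theorem ae_integrable_slice (f : Lp ℂ 2 (volume : Measure (Mom d)))
    (Ψ : Fock d H) (n : ℕ) : ∀ᵐ k : Fin n → Mom d,
      Integrable (fun q : Mom d => conj (f q) • comp Ψ (n + 1) (Fin.cons q k)) volume := by
  filter_upwards [ae_memLp_slice Ψ n] with k hk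
  have hf : MemLp (fun q => conj (f q)) 2 volume := (Lp.memLp f).star
  exact memLp_one_iff_integrable.1 (hk.smul (r := 1) hf)

theorem ae_slice {n : ℕ} {p : (Fin (n + 1) → Mom d) → Prop} (h : ∀ᵐ k, p k) :
    ∀ᵐ k : Fin n → Mom d, ∀ᵐ q : Mom d, p (Fin.cons q k) := by
  have hmp := (volume_preserving_piFinSuccAbove (fun _ : Fin (n + 1) => Mom d) 0).symm
  have h1 := hmp.quasiMeasurePreserving.ae h
  have h2 := (Measure.measurePreserving_swap (μ := (volume : Measure (Fin n → Mom d)))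
        (ν := (volume : Measure (Mom d)))).quasiMeasurePreserving.ae h1
  have h3 := Measure.ae_ae_of_ae_prod h2
  filter_upwards [h3] with k hk
  filter_upwards [hk] with q hq
  simpa [MeasurableEquiv.piFinSuccAbove_symm_apply, Fin.insertNthEquiv, Fin.insertNth_zero]
    using hq

/-- The graph of the annihilation operator `a(f) = I ⊗ a_b(f)`,
`(a(f) Ψ)⁽ⁿ⁾(k₁, …, kₙ) = √(n+1) ∫ conj (f q) Ψ⁽ⁿ⁺¹⁾(q, k₁, …, kₙ) dq`. -/
def annihilationGraph (f : Lp ℂ 2 (volume : Measure (Mom d))) :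
    Submodule ℂ (Fock d H × Fock d H) where
  carrier := {p | ∀ n, ∀ᵐ k, comp p.2 n k =
    (Real.sqrt (n + 1) : ℂ) • ∫ q : Mom d, conj (f q) • comp p.1 (n + 1) (Fin.cons q k)}
  zero_mem' := by
    intro n
    filter_upwards [comp_zero (d := d) (H := H) n,
      ae_slice (comp_zero (d := d) (H := H) (n + 1))] with k h1 h2
    have : (fun q : Mom d => conj (f q) • comp (0 : Fock d H) (n + 1) (Fin.cons q k))
        =ᵐ[volume] 0 := by
      filter_upwards [h2] with q hq
      simp [hq]
    simp only [Prod.fst_zero, Prod.snd_zero, h1]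
    rw [integral_congr_ae this]
    simp
  add_mem' := by
    intro p p' hp hp' n
    filter_upwards [hp n, hp' n, comp_add p.2 p'.2 n, ae_slice (comp_add p.1 p'.1 (n + 1)),
      ae_integrable_slice f p.1 n, ae_integrable_slice f p'.1 n] with k h1 h2 h3 h4 h5 h6
    have : (fun q : Mom d => conj (f q) • comp (p.1 + p'.1) (n + 1) (Fin.cons q k))
        =ᵐ[volume] fun q => conj (f q) • comp p.1 (n + 1) (Fin.cons q k) +
          conj (f q) • comp p'.1 (n + 1) (Fin.cons q k) := by
      filter_upwards [h4] with q hq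
      rw [hq, Pi.add_apply, smul_add]
    simp only [Prod.fst_add, Prod.snd_add, h3, Pi.add_apply]
    rw [integral_congr_ae this, integral_add h5 h6, h1, h2, smul_add]
  smul_mem' := by
    intro c p hp n
    filter_upwards [hp n, comp_smul c p.2 n, ae_slice (comp_smul c p.1 (n + 1))] with k h1 h3 h4
    have : (fun q : Mom d => conj (f q) • comp (c • p.1) (n + 1) (Fin.cons q k))
        =ᵐ[volume] fun q => c • (conj (f q) • comp p.1 (n + 1) (Fin.cons q k)) := by
      filter_upwards [h4] with q hq
      rw [hq, Pi.smul_apply, smul_comm]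
    simp only [Prod.smul_fst, Prod.smul_snd, h3, Pi.smul_apply]
    rw [integral_congr_ae this, integral_smul, h1, smul_comm]

theorem annihilationGraph_single_valued (f : Lp ℂ 2 (volume : Measure (Mom d)))
    (p : Fock d H × Fock d H) (hp : p ∈ annihilationGraph f) (h0 : p.1 = 0) : p.2 = 0 := by
  refine ext_comp fun n => ?_
  filter_upwards [hp n, (annihilationGraph (d := d) (H := H) f).zero_mem n] with k h1 h2
  rw [h0] at h1
  simp only [Prod.fst_zero, Prod.snd_zero] at h2
  rw [h1, h2]

/-- The annihilation operator `a(f) = I ⊗ a_b(f)`, on its maximal domain. -/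
def annihilation (f : Lp ℂ 2 (volume : Measure (Mom d))) : Fock d H →ₗ.[ℂ] Fock d H :=
  (annihilationGraph f).toLinearPMap

theorem annihilation_graph (f : Lp ℂ 2 (volume : Measure (Mom d))) :
    (annihilation f : Fock d H →ₗ.[ℂ] Fock d H).graph = annihilationGraph f :=
  Submodule.toLinearPMap_graph_eq _ (annihilationGraph_single_valued f)

end FockSpace

/-! ### The pull-through kernel and the maximal Carleman operator -/

section PullThrough

variable {d : ℕ} {F : Type*} [NormedAddCommGroup F] [InnerProductSpace ℂ F]

/-- The operator `(S - inf σ(S) + ω(k))⁻¹ B(k)`, on the domain of `B(k)`. -/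
def pullThroughOp (S : F →ₗ.[ℂ] F) (w : Mom d → ℝ) (B : Mom d → F →ₗ.[ℂ] F) (k : Mom d) :
    F →ₗ.[ℂ] F :=
  LinearMap.compPMap (resolventAt S ((groundEnergy S - w k : ℝ) : ℂ) : F →ₗ[ℂ] F) (B k)

/-- The kernel `K(k) = (S - inf σ(S) + ω(k))⁻¹ B(k) Ψ`. Only its values at `k ≠ 0` matter. -/
def pullThroughKernel (S : F →ₗ.[ℂ] F) (w : Mom d → ℝ) (B : Mom d → F →ₗ.[ℂ] F) (Ψ : F)
    (k : Mom d) : F :=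
  applyPMap (pullThroughOp S w B k) Ψ

/-- `M_ε = (∫_{|k| > ε} ‖(S - inf σ(S) + ω(k))⁻¹ B(k)‖² dk)^{1/2}`, with values in `[0, ∞]`. -/
def pullThroughBound (S : F →ₗ.[ℂ] F) (w : Mom d → ℝ) (B : Mom d → F →ₗ.[ℂ] F) (ε : ℝ) : ℝ≥0∞ :=
  (∫⁻ k in {k : Mom d | ε < ‖k‖}, opENorm (pullThroughOp S w B k) ^ 2) ^ (1 / 2 : ℝ)

/-- The maximal Carleman operator `(T Φ)(k) = (K(k), Φ)` from `F` to `L²(ℝ^d)` induced by `K`, with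
domain all `Φ` for which `(K(·), Φ)` is square integrable. -/
def carleman (K : Mom d → F) : F →ₗ.[ℂ] Lp ℂ 2 (volume : Measure (Mom d)) where
  domain :=
    { carrier := {Φ | MemLp (fun k => inner ℂ (K k) Φ) 2 volume}
      zero_mem' := by simp
      add_mem' := by
        intro Φ Φ' h h'
        simpa only [Set.mem_ofPred_eq, inner_add_right] using! h.add h'
      smul_mem' := by
        intro c Φ h
        simpa only [Set.mem_ofPred_eq, inner_smul_right] using! h.const_mul c }
  toFun :=
    { toFun := fun Φ => MemLp.toLp (fun k => inner ℂ (K k) (Φ : F)) Φ.2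
      map_add' := by
        intro Φ Φ'
        rw [← MemLp.toLp_add]
        congr 1
        funext k
        simp
      map_smul' := by
        intro c Φ
        rw [RingHom.id_apply, ← MemLp.toLp_const_smul]
        congr 1
        funext k
        simp }

end PullThrough

end

end QFT

open QFT

/-! Write `K` for the pull-through kernel. Tested against smooth functions supported away from `0`,
the pull-through formula says that `-K(q)` is the pointwise annihilation of a boson of momentum `q`:
for almost every `q`, `K(q)⁽ⁿ⁾ = -√(n+1) Ψ⁽ⁿ⁺¹⁾(q, ·)` (`ae_compCLM_eq_slice`). Squaring,
integrating over `q` and summing over `n` gives `∫ ‖K(q)‖² dq = ∑ n ‖Ψ⁽ⁿ⁾‖²`, both sides possibly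
infinite (`lintegral_enorm_sq_eq_tsum`). The right side is finite exactly when `Ψ` lies in the
domain of `N^{1/2}`.

For an everywhere defined Carleman operator, Parseval at each `k` followed by Tonelli gives `∑ ‖T
eᵢ‖² = ∫ ‖K(k)‖² dk` (`lintegral_enorm_sq_eq_tsum_carleman`). Hence all three conditions express the
finiteness of one quantity.

For the bound, Cauchy–Schwarz gives `‖T‖ ≤ ‖K‖_{L²}`. As `Ψ` is a unit vector, `‖K(k)‖` is at most
the norm of the pull-through operator at `k`, so the integral of `‖K‖²` over `‖k‖ > ε` is at most
`M_ε²`; monotone convergence then yields `‖K‖_{L²} ≤ M₀`.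

Measurability of `K` comes from norm continuity of the resolvent away from `k = 0` and from Pettis
measurability of `k ↦ B(k) Ψ`. -/

namespace QFT

/-! ### Resolvent identity and norm continuity of the resolvent. -/

section Resolvent

variable {F : Type*} [NormedAddCommGroup F] [InnerProductSpace ℂ F]

/-- First resolvent identity: apply `R` to `(S - z) R' y = y - (z - z') R' y`. -/
theorem IsResolventAt.sub_eq {S : F →ₗ.[ℂ] F} {z z' : ℂ} {R R' : F →L[ℂ] F}
    (h : IsResolventAt S z R) (h' : IsResolventAt S z' R') :
    R - R' = (z - z') • R.comp R' := by
  ext y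
  obtain ⟨hy, hSy⟩ := h'.1 y
  have h1 := h.2 ⟨R' y, hy⟩
  have h2 : S ⟨R' y, hy⟩ - z • R' y = y - (z - z') • R' y := by
    rw [sub_eq_iff_eq_add] at hSy
    rw [hSy, sub_smul]
    abel
  rw [h2, map_sub, map_smul, sub_eq_iff_eq_add] at h1
  simp only [sub_apply, smul_apply,
    ContinuousLinearMap.comp_apply]
  rw [h1]
  abel

/-- No bound on `R` is assumed: the resolvent identity itself makes `R` locally bounded, and then
continuous. -/
theorem IsResolventAt.continuousOn {X : Type*} [TopologicalSpace X] {S : F →ₗ.[ℂ] F} {U : Set X}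
    {g : X → ℂ} {R : X → F →L[ℂ] F} (hg : ContinuousOn g U)
    (h : ∀ k ∈ U, IsResolventAt S (g k) (R k)) : ContinuousOn R U := by
  intro k₀ hk₀
  have key : ∀ k ∈ U, ‖R k - R k₀‖ ≤ ‖g k - g k₀‖ * (‖R k‖ * ‖R k₀‖) := by
    intro k hk
    rw [(h k hk).sub_eq (h k₀ hk₀), norm_smul]
    gcongr
    exact ContinuousLinearMap.opNorm_comp_le _ _
  have hg0 : Tendsto (fun k => ‖g k - g k₀‖) (𝓝[U] k₀) (𝓝 0) :=
    tendsto_iff_norm_sub_tendsto_zero.1 (hg k₀ hk₀)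
  -- With this product below `1/2`, `key` gives `‖R k - R k₀‖ ≤ ‖R k‖ / 2`, hence `‖R k‖ ≤ 2 ‖R
  -- k₀‖`.
  have hsmall : ∀ᶠ k in 𝓝[U] k₀, ‖g k - g k₀‖ * ‖R k₀‖ < 1 / 2 := by
    have := hg0.mul_const ‖R k₀‖
    rw [zero_mul] at this
    exact this.eventually_lt_const (by norm_num)
  refine tendsto_iff_norm_sub_tendsto_zero.2 ?_
  have hlim : Tendsto (fun k => ‖g k - g k₀‖ * (2 * ‖R k₀‖ * ‖R k₀‖)) (𝓝[U] k₀) (𝓝 0) := by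
    simpa using hg0.mul_const (2 * ‖R k₀‖ * ‖R k₀‖)
  refine squeeze_zero' (Eventually.of_forall fun _ => norm_nonneg _) ?_ hlim
  filter_upwards [hsmall, self_mem_nhdsWithin] with k hk hkU
  have h1 := key k hkU
  have h2 : ‖R k‖ ≤ 2 * ‖R k₀‖ := by
    have h3 : ‖R k‖ ≤ ‖R k - R k₀‖ + ‖R k₀‖ := by
      simpa using norm_add_le (R k - R k₀) (R k₀)
    nlinarith [norm_nonneg (R k)]
  refine h1.trans ?_
  gcongr

theorem isResolventAt_resolventAt {S : F →ₗ.[ℂ] F} {z : ℂ} (h : z ∉ pmapSpectrum S) :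
    IsResolventAt S z (resolventAt S z) := by
  have h' : ∃ R : F →L[ℂ] F, IsResolventAt S z R := by
    simpa [pmapSpectrum] using h
  rw [resolventAt, dif_pos h']
  exact h'.choose_spec

theorem notMem_pmapSpectrum_of_lt_groundEnergy {S : F →ₗ.[ℂ] F} (h : BddBelow (realSpectrum S))
    {x : ℝ} (hx : x < groundEnergy S) : (x : ℂ) ∉ pmapSpectrum S := fun hmem =>
  hx.not_ge (csInf_le h hmem)

theorem continuousOn_resolventAt_groundEnergy_sub {X : Type*} [TopologicalSpace X]
    {S : F →ₗ.[ℂ] F} (h : BddBelow (realSpectrum S)) {w : X → ℝ} {U : Set X}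
    (hw : ContinuousOn w U) (hpos : ∀ k ∈ U, 0 < w k) :
    ContinuousOn (fun k => resolventAt S ((groundEnergy S - w k : ℝ) : ℂ)) U :=
  IsResolventAt.continuousOn (S := S)
    (Complex.continuous_ofReal.comp_continuousOn (continuousOn_const.sub hw)) fun k hk =>
    isResolventAt_resolventAt (notMem_pmapSpectrum_of_lt_groundEnergy h (sub_lt_self _ (hpos k hk)))

end Resolvent

/-! ### Parseval, countability of orthonormal families, weak measurability. -/

section HilbertSpace

theorem enorm_sq_eq_tsum_lp {ι : Type*} {E : ι → Type*} [∀ i, NormedAddCommGroup (E i)]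
    (f : lp E 2) : ‖f‖ₑ ^ 2 = ∑' i, ‖f i‖ₑ ^ 2 := by
  have h := lp.hasSum_norm (p := 2) (by norm_num) f
  simp only [ENNReal.toReal_ofNat, Real.rpow_ofNat] at h
  have h2 := ENNReal.ofReal_tsum_of_nonneg (fun i => by positivity) h.summable
  rw [h.tsum_eq] at h2
  simpa [ENNReal.ofReal_pow, ofReal_norm] using h2

variable {F : Type*} [NormedAddCommGroup F] [InnerProductSpace ℂ F]

theorem enorm_inner_sq_le (x y : F) : ‖(inner ℂ x y : ℂ)‖ₑ ^ 2 ≤ ‖x‖ₑ ^ 2 * ‖y‖ₑ ^ 2 := by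
  rw [← mul_pow]
  gcongr
  rw [← ofReal_norm, ← ofReal_norm, ← ofReal_norm, ← ENNReal.ofReal_mul (norm_nonneg _)]
  exact ENNReal.ofReal_le_ofReal (norm_inner_le_norm _ _)

theorem _root_.HilbertBasis.enorm_sq_eq_tsum {ι : Type*} (b : HilbertBasis ι ℂ F) (x : F) :
    ‖x‖ₑ ^ 2 = ∑' i, ‖inner ℂ x (b i)‖ₑ ^ 2 := by
  have h := enorm_sq_eq_tsum_lp (b.repr x)
  have h1 : ‖b.repr x‖ₑ = ‖x‖ₑ := by
    rw [← ofReal_norm, ← ofReal_norm, b.repr.norm_map]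
  rw [h1] at h
  rw [h]
  congr 1
  ext i
  rw [b.repr_apply_apply, ← ofReal_norm, ← ofReal_norm, norm_inner_symm]

/-- Distinct members are at distance `√2`, so balls of radius `1/2` around them are disjoint open
sets. -/
theorem _root_.Orthonormal.countable_of_separableSpace [TopologicalSpace.SeparableSpace F]
    {ι : Type*} {v : ι → F} (hv : Orthonormal ℂ v) : Countable ι := by
  have hd : (Set.univ : Set ι).PairwiseDisjoint fun i => Metric.ball (v i) (1 / 2 : ℝ) := by
    intro i _ j _ hij
    refine Metric.ball_disjoint_ball ?_
    rw [dist_eq_norm]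
    have h1 := norm_sub_sq (𝕜 := ℂ) (v i) (v j)
    rw [hv.2 hij, hv.1 i, hv.1 j, map_zero] at h1
    nlinarith [norm_nonneg (v i - v j)]
  exact Set.countable_univ_iff.1 (hd.countable_of_isOpen (fun _ _ => Metric.isOpen_ball)
    fun i _ => ⟨v i, Metric.mem_ball_self (by norm_num)⟩)

/-- Pettis measurability in a separable Hilbert space. -/
theorem aestronglyMeasurable_of_forall_inner [CompleteSpace F]
    [TopologicalSpace.SeparableSpace F] {X : Type*} [MeasurableSpace X] {μ : Measure X}
    {f : X → F} (h : ∀ Φ : F, AEMeasurable (fun x => (inner ℂ Φ (f x) : ℂ)) μ) :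
    AEStronglyMeasurable f μ := by
  obtain ⟨w, b, -⟩ := exists_hilbertBasis ℂ F
  -- Countability makes `atTop` on finite subsets of `w` countably generated, so the Fourier partial
  -- sums below have a measurable limit.
  have : Countable w := b.orthonormal.countable_of_separableSpace
  refine aestronglyMeasurable_of_tendsto_ae (u := atTop)
    (f := fun (s : Finset w) x => ∑ i ∈ s, b.repr (f x) i • b i) ?_ ?_
  · intro s
    refine Finset.aestronglyMeasurable_fun_sum s fun i _ => ?_
    simp only [b.repr_apply_apply]
    exact (h (b i)).aestronglyMeasurable.smul_const _
  · exact Eventually.of_forall fun x => b.hasSum_repr (f x)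

end HilbertSpace

/-! ### Separability of the Fock space. -/

section Fock

variable {d : ℕ} {H : Type*} [NormedAddCommGroup H] [InnerProductSpace ℂ H]

/-- Finite sums of vectors from the countably many separable sectors are dense, by truncation in the
boson number. -/
instance separableSpace_fock [TopologicalSpace.SeparableSpace H] :
    TopologicalSpace.SeparableSpace (Fock d H) := by
  have hsep : TopologicalSpace.IsSeparable
      (⋃ n : ℕ, Set.range (lp.singleContinuousLinearMap ℂ (fun n : ℕ => symL2 d H n) 2 n)) := by
    refine .iUnion fun n => ?_
    have : Fact ((2 : ℝ≥0∞) ≠ ⊤) := ⟨by norm_num⟩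
    have : SecondCountableTopology (Lp H 2 (volume : Measure (Fin n → Mom d))) := inferInstance
    have : SecondCountableTopology (symL2 d H n) := inferInstance
    exact TopologicalSpace.isSeparable_range (ContinuousLinearMap.continuous _)
  have hcl := (hsep.span (R := ℂ)).closure
  refine TopologicalSpace.isSeparable_univ_iff.1 (hcl.mono fun f _ => ?_)
  have h := lp.hasSum_single (p := 2) (by norm_num) f
  refine mem_closure_of_tendsto h (Eventually.of_forall fun s => ?_)
  refine Submodule.sum_mem _ fun n _ => Submodule.subset_span (Set.mem_iUnion.2 ⟨n, f n, ?_⟩)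
  simp

end Fock

/-! ### Square integrability and slices of functions of two variables. -/

section Lintegral

variable {X : Type*} [MeasurableSpace X] {μ : Measure X} {E : Type*} [NormedAddCommGroup E]

theorem eLpNorm_two_sq (f : X → E) : eLpNorm f 2 μ ^ 2 = ∫⁻ x, ‖f x‖ₑ ^ 2 ∂μ := by
  rw [eLpNorm_eq_lintegral_rpow_enorm_toReal (by norm_num) (by norm_num), ← ENNReal.rpow_natCast,
    ← ENNReal.rpow_mul]
  norm_num

theorem memLp_two_iff_lintegral {f : X → E} (hf : AEStronglyMeasurable f μ) :
    MemLp f 2 μ ↔ ∫⁻ x, ‖f x‖ₑ ^ 2 ∂μ < ⊤ := by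
  rw [← eLpNorm_two_sq, ENNReal.pow_lt_top_iff]
  simp [MemLp, hf]

theorem enorm_sq_toLp {f : X → E} (hf : MemLp f 2 μ) :
    ‖hf.toLp f‖ₑ ^ 2 = ∫⁻ x, ‖f x‖ₑ ^ 2 ∂μ := by
  rw [Lp.enorm_toLp, eLpNorm_two_sq]

end Lintegral

section Slice

variable {X Y : Type*} [MeasurableSpace X] [MeasurableSpace Y] {μ : Measure X} {ν : Measure Y}
  [SFinite μ] [SFinite ν] {E : Type*} [NormedAddCommGroup E]

theorem ae_memLp_two_prodMk_left {u : X × Y → E} (hu : MemLp u 2 (μ.prod ν)) :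
    ∀ᵐ x ∂μ, MemLp (fun y => u (x, y)) 2 ν := by
  filter_upwards [hu.1.prodMk_left, ((memLp_two_iff_integrable_sq_norm hu.1).1 hu).prod_right_ae]
    with x h1 h2
  exact (memLp_two_iff_integrable_sq_norm h1).2 h2

open Classical in
/-- The slice `u (x, ·)` of a function of two variables, as an element of `L²`
(`0` if it is not square integrable). -/
noncomputable def slice (ν : Measure Y) (u : X × Y → E) (x : X) : Lp E 2 ν :=
  if h : MemLp (fun y => u (x, y)) 2 ν then h.toLp _ else 0

omit [MeasurableSpace X] [SFinite ν] in
theorem coeFn_slice {u : X × Y → E} {x : X} (h : MemLp (fun y => u (x, y)) 2 ν) :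
    slice ν u x =ᵐ[ν] fun y => u (x, y) := by
  rw [slice, dif_pos h]
  exact h.coeFn_toLp

theorem lintegral_enorm_sq_slice {u : X × Y → E} (hu : MemLp u 2 (μ.prod ν)) :
    ∫⁻ x, ‖slice ν u x‖ₑ ^ 2 ∂μ = ∫⁻ p, ‖u p‖ₑ ^ 2 ∂(μ.prod ν) := by
  rw [lintegral_prod _ (hu.1.enorm.pow_const 2)]
  refine lintegral_congr_ae ?_
  filter_upwards [ae_memLp_two_prodMk_left hu] with x hx
  rw [slice, dif_pos hx, enorm_sq_toLp]

variable [InnerProductSpace ℂ E]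

omit [MeasurableSpace X] [SFinite ν] in
theorem inner_slice {u : X × Y → E} {x : X} (h : MemLp (fun y => u (x, y)) 2 ν) (φ : Lp E 2 ν) :
    inner ℂ φ (slice ν u x) = ∫ y, inner ℂ (φ y) (u (x, y)) ∂ν := by
  rw [L2.inner_def]
  refine integral_congr_ae ?_
  filter_upwards [coeFn_slice h] with y hy
  rw [hy]

/-- Only scalar pairings are shown measurable, through their formula as partial integrals;
measurability of the slice as a vector-valued map is never needed. -/
theorem memLp_two_inner_slice {u : X × Y → E} (hu : MemLp u 2 (μ.prod ν)) (φ : Lp E 2 ν) :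
    MemLp (fun x => (inner ℂ φ (slice ν u x) : ℂ)) 2 μ := by
  have hm : AEStronglyMeasurable (fun x => (inner ℂ φ (slice ν u x) : ℂ)) μ := by
    have h1 : AEStronglyMeasurable (fun p : X × Y => (inner ℂ (φ p.2) (u p) : ℂ)) (μ.prod ν) :=
      ((Lp.memLp φ).1.comp_snd).inner hu.1
    refine h1.integral_prod_right'.congr ?_
    filter_upwards [ae_memLp_two_prodMk_left hu] with x hx
    rw [inner_slice hx]
  rw [memLp_two_iff_lintegral hm]
  have h2 : ∫⁻ x, ‖slice ν u x‖ₑ ^ 2 ∂μ < ⊤ := by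
    rw [lintegral_enorm_sq_slice hu]
    exact (memLp_two_iff_lintegral hu.1).1 hu
  calc ∫⁻ x, ‖(inner ℂ φ (slice ν u x) : ℂ)‖ₑ ^ 2 ∂μ
      ≤ ∫⁻ x, ‖φ‖ₑ ^ 2 * ‖slice ν u x‖ₑ ^ 2 ∂μ := by
        exact lintegral_mono fun x => enorm_inner_sq_le _ _
    _ = ‖φ‖ₑ ^ 2 * ∫⁻ x, ‖slice ν u x‖ₑ ^ 2 ∂μ := lintegral_const_mul' _ _ (by simp)
    _ < ⊤ := ENNReal.mul_lt_top (by simp) h2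

omit [SFinite μ] in
theorem memLp_two_smul_prod {g : X → ℂ} (hg : MemLp g 2 μ) {φ : Y → E} (hφ : MemLp φ 2 ν) :
    MemLp (fun p : X × Y => g p.1 • φ p.2) 2 (μ.prod ν) := by
  have hm : AEStronglyMeasurable (fun p : X × Y => g p.1 • φ p.2) (μ.prod ν) :=
    hg.1.comp_fst.smul hφ.1.comp_snd
  rw [memLp_two_iff_lintegral hm]
  have h : ∀ p : X × Y, ‖g p.1 • φ p.2‖ₑ ^ 2 = ‖g p.1‖ₑ ^ 2 * ‖φ p.2‖ₑ ^ 2 := fun p => by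
    rw [enorm_smul, mul_pow]
  simp only [h]
  rw [lintegral_prod_mul (hg.1.enorm.pow_const 2) (hφ.1.enorm.pow_const 2)]
  exact ENNReal.mul_lt_top ((memLp_two_iff_lintegral hg.1).1 hg)
    ((memLp_two_iff_lintegral hφ.1).1 hφ)

/-- Fubini: pairing with `φ` moves inside the weak integral defining `v`. -/
theorem inner_eq_integral_slice [CompleteSpace E] {u : X × Y → E} (hu : MemLp u 2 (μ.prod ν))
    {g : X → ℂ} (hg : MemLp g 2 μ) (φ v : Lp E 2 ν)
    (hv : v =ᵐ[ν] fun y => ∫ x, g x • u (x, y) ∂μ) :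
    inner ℂ φ v = ∫ x, g x * inner ℂ φ (slice ν u x) ∂μ := by
  have hint : Integrable (fun p : X × Y => g p.1 * (inner ℂ (φ p.2) (u p) : ℂ)) (μ.prod ν) := by
    -- The integrand is the inner product of `conj g ⊗ φ` with `u`, both in `L²` of the product; the
    -- conjugate cancels the one from the first slot.
    have hw := memLp_two_smul_prod hg.star (Lp.memLp φ)
    refine (L2.integrable_inner (𝕜 := ℂ) (hw.toLp _) (hu.toLp _)).congr ?_
    filter_upwards [hw.coeFn_toLp, hu.coeFn_toLp] with p h1 h2
    rw [h1, h2, inner_smul_left]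
    simp
  have hu' : MemLp (fun p : Y × X => u (p.2, p.1)) 2 (ν.prod μ) :=
    hu.comp_measurePreserving Measure.measurePreserving_swap
  calc inner ℂ φ v = ∫ y, ∫ x, g x * inner ℂ (φ y) (u (x, y)) ∂μ ∂ν := by
        rw [L2.inner_def]
        refine integral_congr_ae ?_
        filter_upwards [hv, ae_memLp_two_prodMk_left hu'] with y h1 h2
        have h3 : Integrable (fun x => g x • u (x, y)) μ :=
          memLp_one_iff_integrable.1 (h2.smul (r := 1) hg)
        rw [h1, ← integral_inner h3]
        simp only [inner_smul_right]
    _ = ∫ x, ∫ y, g x * inner ℂ (φ y) (u (x, y)) ∂ν ∂μ := (integral_integral_swap hint).symm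
    _ = ∫ x, g x * inner ℂ φ (slice ν u x) ∂μ := by
        refine integral_congr_ae ?_
        filter_upwards [ae_memLp_two_prodMk_left hu] with x hx
        rw [inner_slice hx, integral_const_mul]

end Slice

/-! ### Fock components with one momentum split off, and the domain of `N^{1/2}`. -/

section Fock

variable {d : ℕ} {H : Type*} [NormedAddCommGroup H] [InnerProductSpace ℂ H]

theorem measurePreserving_cons (d n : ℕ) :
    MeasurePreserving (fun p : Mom d × (Fin n → Mom d) => (Fin.cons p.1 p.2 : Fin (n + 1) → Mom d))
      (volume.prod volume) volume := by
  have h := (volume_preserving_piFinSuccAbove (fun _ : Fin (n + 1) => Mom d) 0).symm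
  refine (congrArg (fun f => MeasurePreserving f (volume.prod volume) volume) ?_).mp h
  funext p
  simp [MeasurableEquiv.piFinSuccAbove_symm_apply, Fin.insertNthEquiv]

/-- The `(n+1)`-boson component with its first momentum split off. -/
noncomputable def splitComp (Ψ : Fock d H) (n : ℕ) (p : Mom d × (Fin n → Mom d)) : H :=
  comp Ψ (n + 1) (Fin.cons p.1 p.2)

theorem memLp_splitComp (Ψ : Fock d H) (n : ℕ) :
    MemLp (splitComp Ψ n) 2 (volume.prod volume) :=
  (memLp_comp Ψ (n + 1)).comp_measurePreserving (measurePreserving_cons d n)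

theorem lintegral_enorm_sq_slice_splitComp (Ψ : Fock d H) (n : ℕ) :
    ∫⁻ q, ‖slice volume (splitComp Ψ n) q‖ₑ ^ 2 = ‖Ψ (n + 1)‖ₑ ^ 2 := by
  rw [lintegral_enorm_sq_slice (memLp_splitComp Ψ n), ← eLpNorm_two_sq]
  have h := eLpNorm_comp_measurePreserving (p := 2) (memLp_comp Ψ (n + 1)).1
    (measurePreserving_cons d n)
  have e : ‖Ψ (n + 1)‖ₑ = eLpNorm (comp Ψ (n + 1)) 2 volume :=
    Lp.enorm_def ((Ψ (n + 1) : symL2 d H (n + 1)) : Lp H 2 (volume : Measure (Fin (n + 1) → Mom d)))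
  rw [e, ← h]
  rfl

/-- The `n`-boson component as a bounded linear map into `L²((ℝ^d)^n; H)`. -/
noncomputable def compCLM (d : ℕ) (H : Type*) [NormedAddCommGroup H] [InnerProductSpace ℂ H]
    (n : ℕ) : Fock d H →L[ℂ] Lp H 2 (volume : Measure (Fin n → Mom d)) :=
  (symL2 d H n).subtypeL.comp (lp.evalCLM ℂ (fun n : ℕ => symL2 d H n) 2 n)

theorem coeFn_compCLM (Ψ : Fock d H) (n : ℕ) : ⇑(compCLM d H n Ψ) = comp Ψ n := rfl

theorem enorm_sq_eq_tsum_compCLM (Ψ : Fock d H) : ‖Ψ‖ₑ ^ 2 = ∑' n, ‖compCLM d H n Ψ‖ₑ ^ 2 :=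
  enorm_sq_eq_tsum_lp Ψ

/-- `Ψ` is in the domain of `N^{1/2}` if and only if `∑ n ‖Ψ⁽ⁿ⁾‖²` converges. -/
theorem mem_domain_sqrtNumberOp_iff (Ψ : Fock d H) :
    Ψ ∈ (sqrtNumberOp d H).domain ↔ ∑' n : ℕ, (n : ℝ≥0∞) * ‖Ψ n‖ₑ ^ 2 < ⊤ := by
  have hsq : ∀ n : ℕ, ‖((Real.sqrt n : ℝ) : ℂ)‖ₑ ^ 2 = (n : ℝ≥0∞) := fun n => by
    rw [← ofReal_norm, ← ENNReal.ofReal_pow (norm_nonneg _), Complex.norm_real, Real.norm_eq_abs,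
      sq_abs, Real.sq_sqrt (Nat.cast_nonneg n), ENNReal.ofReal_natCast]
  -- The almost everywhere condition in the graph becomes an equation between `L²` classes, sector
  -- by sector.
  have hg : (Ψ ∈ (sqrtNumberOp d H).domain) ↔ ∃ Φ : Fock d H, ∀ n,
      Φ n = ((Real.sqrt n : ℝ) : ℂ) • Ψ n := by
    rw [LinearPMap.mem_domain_iff]
    refine exists_congr fun Φ => ?_
    rw [sqrtNumberOp, sqrtDGamma, mulOp_graph]
    refine forall_congr' fun n => ?_
    simp only [Finset.sum_const, Finset.card_univ, Fintype.card_fin, nsmul_eq_mul, mul_one]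
    have hc := Lp.coeFn_smul ((Real.sqrt n : ℝ) : ℂ)
      ((Ψ n : symL2 d H n) : Lp H 2 (volume : Measure (Fin n → Mom d)))
    constructor
    · intro h
      refine Subtype.ext (Lp.ext ?_)
      filter_upwards [h, hc] with k h1 h2
      exact h1.trans h2.symm
    · intro h
      filter_upwards [hc] with k h2
      have h3 : comp Φ n = ⇑(((Real.sqrt n : ℝ) : ℂ) •
        ((Ψ n : symL2 d H n) : Lp H 2 (volume : Measure (Fin n → Mom d)))) := by
        rw [comp, h]
        rfl
      rw [h3, h2]
      rfl
  rw [hg]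
  have hterm : ∀ n : ℕ, ‖((Real.sqrt n : ℝ) : ℂ) • Ψ n‖ₑ ^ 2 = (n : ℝ≥0∞) * ‖Ψ n‖ₑ ^ 2 :=
    fun n => by rw [enorm_smul, mul_pow, hsq]
  simp only [← hterm]
  constructor
  · rintro ⟨Φ, hΦ⟩
    simp only [← hΦ]
    rw [← enorm_sq_eq_tsum_lp Φ]
    simp
  · intro h
    have hmem : Memℓp (fun n : ℕ => ((Real.sqrt n : ℝ) : ℂ) • Ψ n) 2 := by
      refine memℓp_gen ?_
      have h2 := ENNReal.summable_toReal h.ne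
      simpa [ENNReal.toReal_pow] using h2
    exact ⟨⟨_, hmem⟩, fun n => rfl⟩

end Fock

/-! ### Identification of the kernel from the pull-through formula. -/

section PullThrough

variable {d : ℕ} {E : Type*} [NormedAddCommGroup E]

theorem memLp_restrict_of_lintegral {K : Mom d → E} (hK : AEStronglyMeasurable K volume)
    {s : Set (Mom d)} (h : ∫⁻ k in s, ‖K k‖ₑ ^ 2 < ⊤) : MemLp K 2 (volume.restrict s) :=
  (memLp_two_iff_lintegral hK.restrict).2 h

theorem exists_subset_lt_norm {s : Set (Mom d)} (hs : IsClosed s) (h0 : (0 : Mom d) ∉ s) :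
    ∃ ε : ℝ, 0 < ε ∧ s ⊆ {k | ε < ‖k‖} := by
  obtain ⟨ε, hε, h⟩ := Metric.isOpen_iff.1 hs.isOpen_compl 0 h0
  refine ⟨ε / 2, half_pos hε, fun k hk => ?_⟩
  by_contra hlt
  have hlt' : ‖k‖ ≤ ε / 2 := not_lt.1 hlt
  exact h (by simpa using hlt'.trans_lt (half_lt_self hε)) hk

/-- A compact set missing `0` has finite measure and lies in some `ε < ‖k‖`, where `L²` control
implies `L¹` control. -/
theorem locallyIntegrableOn_compl_zero {K : Mom d → E} (hK : AEStronglyMeasurable K volume)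
    (h : ∀ ε : ℝ, 0 < ε → ∫⁻ k in {k : Mom d | ε < ‖k‖}, ‖K k‖ₑ ^ 2 < ⊤) :
    LocallyIntegrableOn K {0}ᶜ volume := by
  refine (locallyIntegrableOn_iff isOpen_compl_singleton.isLocallyClosed).2 fun s hs hsc => ?_
  obtain ⟨ε, hε, hsub⟩ := exists_subset_lt_norm hsc.isClosed fun h0 => hs h0 rfl
  have : IsFiniteMeasure (volume.restrict s) := ⟨by simpa using hsc.measure_lt_top⟩
  exact ((memLp_restrict_of_lintegral hK (h ε hε)).mono_measure
    (Measure.restrict_mono hsub le_rfl)).integrable (by norm_num)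

theorem integrable_smul_of_zero_notMem_tsupport [NormedSpace ℂ E] {K : Mom d → E}
    (hK : AEStronglyMeasurable K volume)
    (h : ∀ ε : ℝ, 0 < ε → ∫⁻ k in {k : Mom d | ε < ‖k‖}, ‖K k‖ₑ ^ 2 < ⊤)
    {f : Mom d → ℂ} (hf : MemLp f 2 volume) (h0 : (0 : Mom d) ∉ tsupport f) :
    Integrable (fun k => f k • K k) volume := by
  obtain ⟨ε, hε, hsub⟩ := exists_subset_lt_norm (isClosed_tsupport f) h0
  have h1 : IntegrableOn (fun k => f k • K k) {k | ε < ‖k‖} volume :=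
    memLp_one_iff_integrable.1
      ((memLp_restrict_of_lintegral hK (h ε hε)).smul (r := 1) (hf.restrict _))
  refine (integrableOn_iff_integrable_of_support_subset ?_).1 h1
  exact (Function.support_smul_subset_left f K).trans ((subset_tsupport f).trans hsub)

/-- A functional of the kernel is determined almost everywhere by its pairings with test functions
supported away from `0`. -/
theorem ae_apply_eq_of_forall_integral_smul [NormedSpace ℂ E] [CompleteSpace E] {K : Mom d → E}
    (hK : AEStronglyMeasurable K volume)
    (hloc : ∀ ε : ℝ, 0 < ε → ∫⁻ k in {k : Mom d | ε < ‖k‖}, ‖K k‖ₑ ^ 2 < ⊤)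
    (L : E →L[ℂ] ℂ) {s : Mom d → ℂ} (hs : MemLp s 2 volume)
    (h : ∀ f : Mom d → ℂ, ContDiff ℝ (⊤ : ℕ∞) f → HasCompactSupport f → 0 ∉ tsupport f →
      (∀ k, conj (f k) = f k) → MemLp f 2 volume → L (∫ k, f k • K k) = ∫ k, f k * s k) :
    ∀ᵐ q, q ∈ ({0}ᶜ : Set (Mom d)) → L (K q) - s q = 0 := by
  have hKn := locallyIntegrableOn_compl_zero hK hloc
  -- The fundamental lemma of the calculus of variations on the complement of `0`. Its test
  -- functions are real, so only self-conjugate `f` are required in `h`.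
  refine isOpen_compl_singleton.ae_eq_zero_of_integral_contDiff_smul_eq_zero ?_ ?_
  · refine LocallyIntegrableOn.sub (fun x hx => ?_) ?_
    · obtain ⟨t, ht, hint⟩ := hKn x hx
      exact ⟨t, ht, L.integrable_comp hint⟩
    · exact (hs.locallyIntegrable (by norm_num)).locallyIntegrableOn _
  · intro g hg hgc hgs
    set f : Mom d → ℂ := fun k => (g k : ℂ) with hf
    have hfs : Function.support f = Function.support g := by
      ext k
      simp [hf]
    have hft : tsupport f = tsupport g := by rw [tsupport, tsupport, hfs]
    have hfc : HasCompactSupport f := by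
      rw [HasCompactSupport, hft]
      exact hgc
    have hfd : ContDiff ℝ (⊤ : ℕ∞) f := Complex.ofRealCLM.contDiff.comp hg
    have h0 : (0 : Mom d) ∉ tsupport f := by
      rw [hft]
      exact fun h => hgs h rfl
    have hfL : MemLp f 2 volume := hfd.continuous.memLp_of_hasCompactSupport hfc
    have hint := integrable_smul_of_zero_notMem_tsupport hK hloc hfL h0
    have hi1 : Integrable (fun k => f k * L (K k)) volume := by
      simpa only [map_smul, smul_eq_mul] using L.integrable_comp hint
    have hi2 : Integrable (fun k => f k * s k) volume :=
      memLp_one_iff_integrable.1 (hs.smul (r := 1) hfL)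
    have h3 : ∀ k, g k • (L (K k) - s k) = f k * L (K k) - f k * s k := fun k => by
      rw [Complex.real_smul, mul_sub]
    simp only [h3]
    rw [integral_sub hi1 hi2, ← h f hfd hfc h0 (fun k => Complex.conj_ofReal _) hfL,
      ← L.integral_comp_comm hint]
    simp only [map_smul, smul_eq_mul, sub_self]

variable {H : Type*} [NormedAddCommGroup H] [InnerProductSpace ℂ H]

theorem inner_compCLM_annihilation [CompleteSpace H] {Ψ Φ : Fock d H} {f : Mom d → ℂ}
    (hf : MemLp f 2 volume) (hreal : ∀ k, conj (f k) = f k)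
    (hmem : (Ψ, Φ) ∈ (annihilation (hf.toLp f) : Fock d H →ₗ.[ℂ] Fock d H).graph) (n : ℕ)
    (φ : Lp H 2 (volume : Measure (Fin n → Mom d))) :
    inner ℂ φ (compCLM d H n Φ) = ∫ q, f q * (((Real.sqrt (n + 1) : ℝ) : ℂ) *
      inner ℂ φ (slice volume (splitComp Ψ n) q)) := by
  rw [annihilation_graph] at hmem
  have hv : ⇑(compCLM d H n Φ) =ᵐ[volume]
      fun y => ∫ q, (((Real.sqrt (n + 1) : ℝ) : ℂ) * f q) • splitComp Ψ n (q, y) := by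
    filter_upwards [hmem n] with y hy
    rw [coeFn_compCLM, hy, ← integral_smul]
    refine integral_congr_ae ?_
    filter_upwards [hf.coeFn_toLp] with q hq
    rw [hq, hreal, smul_smul]
    rfl
  rw [inner_eq_integral_slice (memLp_splitComp Ψ n) (hf.const_mul _) φ _ hv]
  refine integral_congr_ae (Eventually.of_forall fun q => ?_)
  ring

/-- The pull-through formula, tested against smooth functions supported away from `0`, determines
the components of the kernel: `K(q)⁽ⁿ⁾ = -√(n+1) Ψ⁽ⁿ⁺¹⁾(q, ·)` for almost every `q`. -/
theorem ae_compCLM_eq_slice [CompleteSpace H] [TopologicalSpace.SeparableSpace H] (hd : 0 < d)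
    {Ψ : Fock d H} {K : Mom d → Fock d H} (hK : AEStronglyMeasurable K volume)
    (hloc : ∀ ε : ℝ, 0 < ε → ∫⁻ k in {k : Mom d | ε < ‖k‖}, ‖K k‖ₑ ^ 2 < ⊤)
    (hpt : ∀ f : Mom d → ℂ, ContDiff ℝ (⊤ : ℕ∞) f → HasCompactSupport f → 0 ∉ tsupport f →
      ∀ hf : MemLp f 2 volume,
        (Ψ, -∫ k, starRingEnd ℂ (f k) • K k) ∈
          (annihilation (hf.toLp f) : Fock d H →ₗ.[ℂ] Fock d H).graph) (n : ℕ) :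
    ∀ᵐ q, compCLM d H n (K q) =
      -(((Real.sqrt (n + 1) : ℝ) : ℂ) • slice volume (splitComp Ψ n) q) := by
  -- Positive dimension makes the momentum space nontrivial, so that `{0}` is a null set.
  have : Nonempty (Fin d) := ⟨⟨0, hd⟩⟩
  have key : ∀ φ : Lp H 2 (volume : Measure (Fin n → Mom d)), ∀ᵐ q, q ∈ ({0}ᶜ : Set (Mom d)) →
      (innerSL ℂ φ).comp (compCLM d H n) (K q) -
        -(((Real.sqrt (n + 1) : ℝ) : ℂ) * inner ℂ φ (slice volume (splitComp Ψ n) q)) = 0 := by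
    intro φ
    refine ae_apply_eq_of_forall_integral_smul hK hloc _
      ((memLp_two_inner_slice (memLp_splitComp Ψ n) φ).const_mul _).neg ?_
    intro f hfd hfc h0 hreal hf
    have h1 := inner_compCLM_annihilation hf hreal (hpt f hfd hfc h0 hf) n φ
    simp only [hreal, map_neg, inner_neg_right] at h1
    simp only [ContinuousLinearMap.comp_apply, innerSL_apply_apply, mul_neg,
      integral_neg, ← h1, neg_neg]
    rfl
  have : Fact ((2 : ℝ≥0∞) ≠ ⊤) := ⟨by norm_num⟩
  have : SecondCountableTopology (Lp H 2 (volume : Measure (Fin n → Mom d))) := inferInstance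
  have hne : ∀ᵐ q : Mom d, q ∈ ({0}ᶜ : Set (Mom d)) :=
    compl_mem_ae_iff.2 (measure_singleton (0 : Mom d))
  -- The null set in `key` depends on `φ`; a countable dense sequence of `φ` gives a common one, and
  -- a vector orthogonal to a dense set vanishes.
  filter_upwards [ae_all_iff.2 fun i => key (TopologicalSpace.denseSeq _ i), hne] with q hq hq0
  rw [eq_neg_iff_add_eq_zero]
  refine (TopologicalSpace.denseRange_denseSeq _).eq_zero_of_inner_right ℂ fun i => ?_
  have h := hq i hq0
  rw [sub_neg_eq_add] at h
  rw [inner_add_right, inner_smul_right]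
  exact h

/-- The square integral of the pull-through kernel is the expectation of the number operator. -/
theorem lintegral_enorm_sq_eq_tsum {Ψ : Fock d H} {K : Mom d → Fock d H}
    (hK : AEStronglyMeasurable K volume)
    (h : ∀ n, ∀ᵐ q, compCLM d H n (K q) =
      -(((Real.sqrt (n + 1) : ℝ) : ℂ) • slice volume (splitComp Ψ n) q)) :
    ∫⁻ q, ‖K q‖ₑ ^ 2 = ∑' n : ℕ, (n : ℝ≥0∞) * ‖Ψ n‖ₑ ^ 2 := by
  have hterm : ∀ n : ℕ, ∫⁻ q, ‖compCLM d H n (K q)‖ₑ ^ 2 =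
      ((n + 1 : ℕ) : ℝ≥0∞) * ‖Ψ (n + 1)‖ₑ ^ 2 := by
    intro n
    have hsq : ‖((Real.sqrt (n + 1) : ℝ) : ℂ)‖ₑ ^ 2 = ((n + 1 : ℕ) : ℝ≥0∞) := by
      rw [← ofReal_norm, ← ENNReal.ofReal_pow (norm_nonneg _), Complex.norm_real,
        Real.norm_eq_abs, sq_abs, Real.sq_sqrt (by positivity), ← ENNReal.ofReal_natCast]
      push_cast
      rfl
    rw [← lintegral_enorm_sq_slice_splitComp, ← lintegral_const_mul' _ _ (by simp)]
    refine lintegral_congr_ae ?_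
    filter_upwards [h n] with q hq
    rw [hq, enorm_neg, enorm_smul, mul_pow, hsq]
  simp only [enorm_sq_eq_tsum_compCLM]
  rw [lintegral_tsum fun n =>
    ((compCLM d H n).continuous.comp_aestronglyMeasurable hK).enorm.pow_const 2]
  simp only [hterm]
  -- The vacuum term has weight `0`, which absorbs the shift from `n + 1` to `n`.
  rw [tsum_eq_zero_add' (f := fun n : ℕ => (n : ℝ≥0∞) * ‖Ψ n‖ₑ ^ 2) ENNReal.summable]
  simp

end PullThrough

/-! ### Carleman operators: norm bound and Hilbert–Schmidt criterion. -/

section Carleman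

variable {d : ℕ} {F : Type*} [NormedAddCommGroup F] [InnerProductSpace ℂ F]

theorem applyPMap_of_mem {G : Type*} [NormedAddCommGroup G] [InnerProductSpace ℂ G]
    (S : F →ₗ.[ℂ] G) {x : F} (h : x ∈ S.domain) : applyPMap S x = S ⟨x, h⟩ := dif_pos h

theorem enorm_sq_carleman (K : Mom d → F) (x : (carleman K).domain) :
    ‖carleman K x‖ₑ ^ 2 = ∫⁻ k, ‖(inner ℂ (K k) (x : F) : ℂ)‖ₑ ^ 2 :=
  enorm_sq_toLp x.2

theorem carleman_domain_eq_top {K : Mom d → F} (hK : MemLp K 2 volume) :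
    (carleman K).domain = ⊤ := by
  refine eq_top_iff.2 fun x _ => ?_
  refine (memLp_two_iff_lintegral (hK.1.inner aestronglyMeasurable_const)).2 ?_
  refine (lintegral_mono fun k => enorm_inner_sq_le (K k) x).trans_lt ?_
  rw [lintegral_mul_const' _ _ (by simp)]
  exact ENNReal.mul_lt_top ((memLp_two_iff_lintegral hK.1).1 hK) (by simp)

/-- Cauchy–Schwarz under the integral. In `[0, ∞]` this needs neither measurability nor square
integrability of `K`. -/
theorem enorm_carleman_le (K : Mom d → F) (x : (carleman K).domain) :
    ‖carleman K x‖ₑ ≤ eLpNorm K 2 volume * ‖(x : F)‖ₑ := by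
  refine (ENNReal.pow_le_pow_left_iff two_ne_zero).1 ?_
  rw [enorm_sq_carleman, mul_pow, eLpNorm_two_sq, ← lintegral_mul_const' _ _ (by simp)]
  exact lintegral_mono fun k => enorm_inner_sq_le (K k) x

theorem opENorm_carleman_le (K : Mom d → F) : opENorm (carleman K) ≤ eLpNorm K 2 volume := by
  refine iSup₂_le fun x hx => (enorm_carleman_le K x).trans ?_
  have h : ‖(x : F)‖ₑ ≤ 1 := by
    rw [← ofReal_norm]
    exact ENNReal.ofReal_le_one.2 hx
  exact mul_le_of_le_one_right' h

theorem isBddPMap_carleman {K : Mom d → F} (hK : MemLp K 2 volume) : IsBddPMap (carleman K) := by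
  refine ⟨(eLpNorm K 2 volume).toReal, fun x => ?_⟩
  have h := ENNReal.toReal_mono (ENNReal.mul_ne_top hK.2.ne (by simp)) (enorm_carleman_le K x)
  simpa using h

variable [TopologicalSpace.SeparableSpace F]

/-- Parseval for `K k` at each `k`, then interchange of sum and integral; separability makes the sum
countable. -/
theorem lintegral_enorm_sq_eq_tsum_carleman {K : Mom d → F} (hK : AEStronglyMeasurable K volume)
    (hdom : (carleman K).domain = ⊤) {ι : Type*} (b : HilbertBasis ι ℂ F) :
    ∫⁻ k, ‖K k‖ₑ ^ 2 = ∑' i, ‖applyPMap (carleman K) (b i)‖ₑ ^ 2 := by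
  have : Countable ι := b.orthonormal.countable_of_separableSpace
  simp only [b.enorm_sq_eq_tsum]
  rw [lintegral_tsum fun i => (hK.inner aestronglyMeasurable_const).enorm.pow_const 2]
  refine tsum_congr fun i => ?_
  have hi : b i ∈ (carleman K).domain := hdom ▸ Submodule.mem_top
  rw [applyPMap_of_mem _ hi, enorm_sq_carleman]

/-- The maximal Carleman operator is Hilbert-Schmidt if and only if its kernel is square
integrable. -/
theorem isHilbertSchmidt_carleman_iff [CompleteSpace F] {K : Mom d → F} (hK : AEStronglyMeasurable K volume) :
    IsHilbertSchmidt (carleman K) ↔ ∫⁻ k, ‖K k‖ₑ ^ 2 < ⊤ := by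
  constructor
  · rintro ⟨hdom, -, w, b, hb⟩
    rw [lintegral_enorm_sq_eq_tsum_carleman hK hdom b]
    have h := ENNReal.ofReal_tsum_of_nonneg (fun i => by positivity) hb
    simp only [ENNReal.ofReal_pow (norm_nonneg _), ofReal_norm] at h
    rw [← h]
    exact ENNReal.ofReal_lt_top
  · intro h
    have hL : MemLp K 2 volume := (memLp_two_iff_lintegral hK).2 h
    have hdom := carleman_domain_eq_top hL
    obtain ⟨w, b, -⟩ := exists_hilbertBasis ℂ F
    refine ⟨hdom, isBddPMap_carleman hL, w, b, ?_⟩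
    rw [lintegral_enorm_sq_eq_tsum_carleman hK hdom b] at h
    simpa [ENNReal.toReal_pow] using ENNReal.summable_toReal h.ne

end Carleman

/-! ### Measurability and size of the pull-through kernel. -/

section Kernel

variable {d : ℕ} {F : Type*} [NormedAddCommGroup F] [InnerProductSpace ℂ F]

theorem pullThroughKernel_eq {S : F →ₗ.[ℂ] F} {w : Mom d → ℝ} {B : Mom d → F →ₗ.[ℂ] F} {Ψ : F}
    {k : Mom d} (h : Ψ ∈ (B k).domain) : pullThroughKernel S w B Ψ k =
      resolventAt S ((groundEnergy S - w k : ℝ) : ℂ) (applyPMap (B k) Ψ) := by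
  rw [pullThroughKernel, applyPMap_of_mem (pullThroughOp S w B k) (x := Ψ) h, applyPMap_of_mem _ h]
  rfl

theorem aestronglyMeasurable_pullThroughKernel [CompleteSpace F]
    [TopologicalSpace.SeparableSpace F] (hd : 0 < d) {S : F →ₗ.[ℂ] F}
    (hS : BddBelow (realSpectrum S)) {w : Mom d → ℝ} (hw : Continuous w)
    (hpos : ∀ k, k ≠ 0 → 0 < w k) {B : Mom d → F →ₗ.[ℂ] F} {Ψ : F}
    (hΨ : ∀ k, k ≠ 0 → Ψ ∈ (B k).domain)
    (hB : ∀ Φ : F, AEMeasurable (fun k => (inner ℂ Φ (applyPMap (B k) Ψ) : ℂ)) volume) :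
    AEStronglyMeasurable (pullThroughKernel S w B Ψ) volume := by
  have : Nonempty (Fin d) := ⟨⟨0, hd⟩⟩
  have hne : ({0}ᶜ : Set (Mom d)) ∈ ae (volume : Measure (Mom d)) :=
    compl_mem_ae_iff.2 (measure_singleton (0 : Mom d))
  have hR : AEStronglyMeasurable (fun k => resolventAt S ((groundEnergy S - w k : ℝ) : ℂ))
      (volume : Measure (Mom d)) := by
    rw [← Measure.restrict_eq_self_of_ae_mem hne]
    exact (continuousOn_resolventAt_groundEnergy_sub hS hw.continuousOn hpos).aestronglyMeasurable
      (measurableSet_singleton _).compl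
  -- The kernel is the jointly continuous evaluation of the resolvent at `B(k) Ψ`, both measurable
  -- in `k`.
  refine ((isBoundedBilinearMap_apply (𝕜 := ℂ)).continuous.comp_aestronglyMeasurable
    (hR.prodMk (aestronglyMeasurable_of_forall_inner hB))).congr ?_
  filter_upwards [hne] with k hk
  exact (pullThroughKernel_eq (hΨ k hk)).symm

theorem enorm_pullThroughKernel_le {S : F →ₗ.[ℂ] F} {w : Mom d → ℝ} {B : Mom d → F →ₗ.[ℂ] F}
    {Ψ : F} (hn : ‖Ψ‖ = 1) {k : Mom d} (h : Ψ ∈ (B k).domain) :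
    ‖pullThroughKernel S w B Ψ k‖ₑ ≤ opENorm (pullThroughOp S w B k) := by
  rw [pullThroughKernel, applyPMap_of_mem (pullThroughOp S w B k) (x := Ψ) h]
  exact le_iSup₂_of_le (⟨Ψ, h⟩ : (pullThroughOp S w B k).domain) hn.le le_rfl

theorem pullThroughBound_sq (S : F →ₗ.[ℂ] F) (w : Mom d → ℝ) (B : Mom d → F →ₗ.[ℂ] F) (ε : ℝ) :
    pullThroughBound S w B ε ^ 2 =
      ∫⁻ k in {k : Mom d | ε < ‖k‖}, opENorm (pullThroughOp S w B k) ^ 2 := by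
  rw [pullThroughBound, ← ENNReal.rpow_natCast, ← ENNReal.rpow_mul]
  norm_num

theorem antitone_pullThroughBound (S : F →ₗ.[ℂ] F) (w : Mom d → ℝ) (B : Mom d → F →ₗ.[ℂ] F) :
    Antitone (pullThroughBound S w B) := by
  intro ε ε' h
  refine ENNReal.rpow_le_rpow ?_ (by norm_num)
  exact lintegral_mono_set fun k hk => lt_of_le_of_lt h hk

theorem lintegral_pullThroughKernel_le {S : F →ₗ.[ℂ] F} {w : Mom d → ℝ}
    {B : Mom d → F →ₗ.[ℂ] F} {Ψ : F} (hn : ‖Ψ‖ = 1) (hΨ : ∀ k, k ≠ 0 → Ψ ∈ (B k).domain)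
    {ε : ℝ} (hε : 0 < ε) :
    ∫⁻ k in {k : Mom d | ε < ‖k‖}, ‖pullThroughKernel S w B Ψ k‖ₑ ^ 2 ≤
      pullThroughBound S w B ε ^ 2 := by
  rw [pullThroughBound_sq]
  refine setLIntegral_mono' (measurableSet_lt measurable_const measurable_norm) fun k hk => ?_
  gcongr
  exact enorm_pullThroughKernel_le hn (hΨ k (norm_pos_iff.1 (hε.trans hk)))

/-- Monotone convergence along the regions `‖k‖ > 1/(n+1)`, which exhaust the complement of the null
set `{0}`. -/
theorem lintegral_le_of_forall_lintegral_lt_norm_le (hd : 0 < d) {g : Mom d → ℝ≥0∞} {C : ℝ≥0∞}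
    (h : ∀ ε : ℝ, 0 < ε → ∫⁻ k in {k : Mom d | ε < ‖k‖}, g k ≤ C) : ∫⁻ k, g k ≤ C := by
  have : Nonempty (Fin d) := ⟨⟨0, hd⟩⟩
  have hU : (⋃ n : ℕ, {k : Mom d | 1 / ((n : ℝ) + 1) < ‖k‖}) = {0}ᶜ := by
    ext k
    simp only [Set.mem_iUnion, Set.mem_ofPred_eq, Set.mem_compl_iff, Set.mem_singleton_iff]
    refine ⟨fun ⟨n, hn⟩ => norm_pos_iff.1 (lt_trans (by positivity) hn), fun hk => ?_⟩
    exact exists_nat_one_div_lt (norm_pos_iff.2 hk)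
  have hne : ({0}ᶜ : Set (Mom d)) ∈ ae (volume : Measure (Mom d)) :=
    compl_mem_ae_iff.2 (measure_singleton (0 : Mom d))
  have hre : (volume : Measure (Mom d)).restrict {0}ᶜ = volume :=
    Measure.restrict_eq_self_of_ae_mem hne
  rw [← hre, ← hU, setLIntegral_iUnion_of_directed]
  · exact iSup_le fun n => h _ (by positivity)
  · refine Monotone.directed_le fun m n hmn k hk => ?_
    refine lt_of_le_of_lt (b := 1 / ((m : ℝ) + 1)) ?_ hk
    exact one_div_le_one_div_of_le (by positivity) (by simpa using hmn)

end Kernel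

end QFT

/-! ### The main theorem. -/

theorem theorem3 {d : ℕ} (hd : 0 < d)
    {H : Type*} [NormedAddCommGroup H] [InnerProductSpace ℂ H] [CompleteSpace H]
    [TopologicalSpace.SeparableSpace H]
    (A : H →ₗ.[ℂ] H) (hA : IsSelfAdjoint A) (hAbdd : IsSemibounded A)
    (ω : Mom d → ℝ) (hω : Continuous ω) (hω0 : ∀ k, 0 ≤ ω k) (hωpos : ∀ k, k ≠ 0 → 0 < ω k)
    (hωinf : ∀ ε : ℝ, 0 < ε → ∃ c : ℝ, 0 < c ∧ ∀ k, ε < ‖k‖ → c ≤ ω k)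
    -- the interaction Hamiltonian and the total Hamiltonian
    (HI HQFT : Fock d H →ₗ.[ℂ] Fock d H) (hHQFT : HQFT = freeHamiltonian A ω + HI)
    (hsa : IsSelfAdjoint HQFT) (hdom : HQFT.domain = (freeHamiltonian A ω).domain)
    -- the ground state
    (Ψ : Fock d H) (hΨ : IsGroundState HQFT Ψ)
    -- the pull-through operators
    (B : Mom d → Fock d H →ₗ.[ℂ] Fock d H)
    (hBdom : ∀ k, k ≠ 0 → (freeHamiltonian A ω).domain ≤ (B k).domain)
    (hBmeas : ∀ Υ ∈ (freeHamiltonian A ω).domain, ∀ Φ : Fock d H,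
      AEMeasurable (fun k => inner ℂ Φ (applyPMap (B k) Υ)) volume)
    -- the operator-theoretical pull-through formula
    (hOPPT : ∀ f : Mom d → ℂ, ContDiff ℝ (⊤ : ℕ∞) f → HasCompactSupport f → 0 ∉ tsupport f →
      ∀ hf : MemLp f 2 volume,
        (Ψ, -∫ k, starRingEnd ℂ (f k) • pullThroughKernel HQFT ω B Ψ k) ∈
          (annihilation (hf.toLp f) : Fock d H →ₗ.[ℂ] Fock d H).graph)
    (hRBbdd : ∀ k, k ≠ 0 → IsBddPMap (pullThroughOp HQFT ω B k))
    (hM : ∀ ε : ℝ, 0 < ε → pullThroughBound HQFT ω B ε < ⊤) :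
    List.TFAE
        [Ψ ∈ (sqrtNumberOp d H).domain,
          MemLp (fun k => ‖pullThroughKernel HQFT ω B Ψ k‖) 2 volume,
          IsHilbertSchmidt (carleman (pullThroughKernel HQFT ω B Ψ))] ∧
      (IsHilbertSchmidt (carleman (pullThroughKernel HQFT ω B Ψ)) →
        ∃ M₀ : ENNReal, Tendsto (pullThroughBound HQFT ω B) (𝓝[>] 0) (𝓝 M₀) ∧
          opENorm (carleman (pullThroughKernel HQFT ω B Ψ)) ≤ M₀ ∧
          opENorm (carleman (pullThroughKernel HQFT ω B Ψ)) < ⊤) := by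
  obtain ⟨hΨdom, -⟩ := hΨ.eigen
  have hΨ0 : Ψ ∈ (freeHamiltonian A ω).domain := hdom ▸ hΨdom
  have hΨB : ∀ k, k ≠ 0 → Ψ ∈ (B k).domain := fun k hk => hBdom k hk hΨ0
  have hK : AEStronglyMeasurable (pullThroughKernel HQFT ω B Ψ) volume :=
    aestronglyMeasurable_pullThroughKernel hd hΨ.bddBelow hω hωpos hΨB (hBmeas Ψ hΨ0)
  have hloc : ∀ ε : ℝ, 0 < ε →
      ∫⁻ k in {k : Mom d | ε < ‖k‖}, ‖pullThroughKernel HQFT ω B Ψ k‖ₑ ^ 2 < ⊤ := fun ε hε =>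
    (lintegral_pullThroughKernel_le hΨ.norm_eq_one hΨB hε).trans_lt (ENNReal.pow_lt_top (hM ε hε))
  have hsum := lintegral_enorm_sq_eq_tsum hK (ae_compCLM_eq_slice hd hK hloc hOPPT)
  have h2 : MemLp (fun k => ‖pullThroughKernel HQFT ω B Ψ k‖) 2 volume ↔
      ∫⁻ k, ‖pullThroughKernel HQFT ω B Ψ k‖ₑ ^ 2 < ⊤ := by
    rw [memLp_norm_iff hK, memLp_two_iff_lintegral hK]
  refine ⟨?_, fun hHS => ?_⟩
  -- After rewriting, all three conditions read `∑ n ‖Ψ⁽ⁿ⁾‖² < ∞`.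
  · rw [mem_domain_sqrtNumberOp_iff, isHilbertSchmidt_carleman_iff hK, h2, hsum]
    tfae_finish
  · have hanti := antitone_pullThroughBound HQFT ω B
    have hfin := (isHilbertSchmidt_carleman_iff hK).1 hHS
    have hlt : eLpNorm (pullThroughKernel HQFT ω B Ψ) 2 volume < ⊤ :=
      ((memLp_two_iff_lintegral hK).2 hfin).2
    -- By monotonicity the limit `M₀` is the supremum of `M_ε` over `ε > 0`, so each `M_ε` is at
    -- most `M₀`.
    refine ⟨_, hanti.antitoneOn _ |>.tendsto_nhdsGT ⟨⊤, fun _ _ => le_top⟩,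
      (opENorm_carleman_le _).trans ?_, (opENorm_carleman_le _).trans_lt hlt⟩
    refine (ENNReal.pow_le_pow_left_iff two_ne_zero).1 ?_
    rw [eLpNorm_two_sq]
    refine lintegral_le_of_forall_lintegral_lt_norm_le hd fun ε hε =>
      (lintegral_pullThroughKernel_le hΨ.norm_eq_one hΨB hε).trans ?_
    gcongr
    exact le_sSup (Set.mem_image_of_mem _ hε)
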